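/- Let $B$ be a quaternion algebra over $\mathbb Q$ with main involution $x\mapsto\bar x$, and let $p$ be a prime at which $B$ is ramified, i.e. $B_p=B\otimes_{\mathbb Q}\mathbb Q_p$ is a division algebra. For $m\in M_2(B_p)$ put $m^*=\overline m^{\,t}$, and let $$GU_2(B_p)=\{g\in M_2(B_p): g^*g=\nu(g)I,\ \nu(g)\in\mathbb Q_p^\times\},\qquad U_p=\{A\in M_2(B_p): A^*=A\},$$ where $GU_2(B_p)$ acts on $U_p$ by conjugation $A\mapsto gAg^{-1}$, the subgroup $\mathbb Q_p^\times$ of scalar matrices acting trivially. Let $R_p$ be the maximal order of $B_p$, let $\mathfrak p\subset R_p$ be its maximal ideal, consisting of the elements of $R_p$ whose reduced norm is divisible by $p$, and let $\xi\in M_2(B_p)$ be such that $\xi^*\xi=\begin{pmatrix}0&1\\1&0\end{pmatrix}$. Put $$L_p=\xi\begin{pmatrix}\mathfrak p\\ R_p\end{pmatrix}\subset B_p^2,\qquad K_p^-=\{g\in GU_2(B_p): gL_p=L_p\},\qquad \omega_p=\xi\begin{pmatrix}0&p\\1&0\end{pmatrix}\xi^{-1}\in GU_2(B_p),$$ $$\mathfrak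 U_p^-=\xi\left\{\begin{pmatrix}r&ps\\ t&\bar r\end{pmatrix}: r\in R_p,\ s,t\in\mathbb Z_p\right\}\xi^{-1}.$$ Then: 1. $\mathfrak U_p^-$ is a $\mathbb Z_p$-lattice in $U_p$ (a finitely generated $\mathbb Z_p$-submodule spanning $U_p$ over $\mathbb Q_p$), and it is preserved under conjugation by every element of $K_p^-$ and by the Atkin–Lehner element $\omega_p$: $g\,\mathfrak U_p^-g^{-1}=\mathfrak U_p^-$ for all $g\in K_p^-$ and for $g=\omega_p$. 2. The subgroup of $GU_2(B_p)/\mathbb Q_p^\times$ generated by the images of $K_p^-$ and $\omega_p$ is the full stabiliser of $\mathfrak U_p^-$ in $GU_2(B_p)/\mathbb Q_p^\times$. -/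

import Mathlib

open scoped Quaternion Matrix TensorProduct

noncomputable section

namespace QuatUnitary

/-- The completion `B_p = B ⊗ ℚ_p` of the quaternion algebra `B = ℍ[ℚ, a, b]` over `ℚ`
(generators `i, j` with `i² = a`, `j² = b`, `ij = -ji`). In characteristic zero every quaternion
algebra has this form. The main involution of `B_p` is Mathlib's `star` on `ℍ[ℚ_[p], a, b]`.
See `exists_baseChange` for the identification with the tensor product. -/
abbrev Bp (p : ℕ) [Fact p.Prime] (a b : ℚ) : Type :=
  ℍ[ℚ_[p], (a : ℚ_[p]), (b : ℚ_[p])]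

/-- `B_p` is the base change of `B` to `ℚ_p`, compatibly with the main involutions. -/
theorem exists_baseChange (p : ℕ) [Fact p.Prime] (a b : ℚ) :
    ∃ e : ℚ_[p] ⊗[ℚ] ℍ[ℚ, a, b] ≃ₐ[ℚ_[p]] Bp p a b,
      ∀ (c : ℚ_[p]) (x : ℍ[ℚ, a, b]), e (c ⊗ₜ[ℚ] star x) = star (e (c ⊗ₜ[ℚ] x)) := by
  let f : ℍ[ℚ, a, b] →ₐ[ℚ] ℍ[ℚ_[p], (a : ℚ_[p]), (b : ℚ_[p])] :=
    AlgHom.ofLinearMap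
      { toFun := fun x => ⟨x.re, x.imI, x.imJ, x.imK⟩
        map_add' := fun x y => by ext <;> simp
        map_smul' := fun c x => by
          ext <;> simp [Rat.smul_def] }
      (by ext <;> simp) (fun x y => by ext <;> simp)
  have hf (x) : f x = ⟨x.re, x.imI, x.imJ, x.imK⟩ := rfl
  let g : ℚ_[p] ⊗[ℚ] ℍ[ℚ, a, b] →ₐ[ℚ_[p]] ℍ[ℚ_[p], (a : ℚ_[p]), (b : ℚ_[p])] :=
    Algebra.TensorProduct.lift (Algebra.ofId _ _) f (fun c x => Algebra.commutes _ _)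
  have hg (c : ℚ_[p]) (x) : g (c ⊗ₜ x) = c • f x := by
    refine (Algebra.TensorProduct.lift_tmul _ _ _ c x).trans ?_
    rw [Algebra.ofId_apply, Algebra.smul_def]
  have hsurj : Function.Surjective g := by
    intro y
    refine ⟨y.re ⊗ₜ 1 + y.imI ⊗ₜ ⟨0, 1, 0, 0⟩ + y.imJ ⊗ₜ ⟨0, 0, 1, 0⟩ +
      y.imK ⊗ₜ ⟨0, 0, 0, 1⟩, ?_⟩
    simp only [map_add, hg, hf]
    ext <;> simp
  have hinj : Function.Injective g := by
    change Function.Injective g.toLinearMap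
    refine (LinearMap.injective_iff_surjective_of_finrank_eq_finrank ?_).2 hsurj
    rw [Module.finrank_baseChange, QuaternionAlgebra.finrank_eq_four,
      QuaternionAlgebra.finrank_eq_four]
  refine ⟨AlgEquiv.ofBijective g ⟨hinj, hsurj⟩, fun c x => ?_⟩
  have he (z) : AlgEquiv.ofBijective g ⟨hinj, hsurj⟩ z = g z := rfl
  rw [he, he, hg, hg, QuaternionAlgebra.star_smul, hf, hf]
  congr 1

/-- `B` is ramified at `p`: the completion `B_p` is a division algebra. -/
def IsRamifiedAt (p : ℕ) [Fact p.Prime] (a b : ℚ) : Prop :=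
  ∀ x : Bp p a b, x ≠ 0 → IsUnit x

/-- The reduced norm `x * star x` of `B_p`, as an element of `ℚ_p`. -/
def nrd {p : ℕ} [Fact p.Prime] {a b : ℚ} (x : Bp p a b) : ℚ_[p] := (x * star x).re

theorem algebraMap_nrd {p : ℕ} [Fact p.Prime] {a b : ℚ} (x : Bp p a b) :
    algebraMap ℚ_[p] (Bp p a b) (nrd x) = x * star x :=
  (QuaternionAlgebra.mul_star_eq_coe x).symm

/-- A maximal order of `B_p`: a `ℤ_p`-subalgebra that is a full lattice in `B_p` (an order), and
that is not properly contained in another order. -/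
def IsMaximalOrder {p : ℕ} [Fact p.Prime] {a b : ℚ} (R : Subalgebra ℤ_[p] (Bp p a b)) : Prop :=
  Maximal (fun R' : Subalgebra ℤ_[p] (Bp p a b) =>
    Submodule.IsLattice ℚ_[p] (Subalgebra.toSubmodule R')) R

/-- The matrix algebra `M_2(B_p)`; its involution `m ↦ m^*` (transpose of the entrywise main
involution) is `Matrix.conjTranspose`, written `mᴴ`. -/
abbrev M2 (p : ℕ) [Fact p.Prime] (a b : ℚ) : Type := Matrix (Fin 2) (Fin 2) (Bp p a b)

/-- `GU_2(B_p) = {g ∈ M_2(B_p) : g^* g = ν(g) I, ν(g) ∈ ℚ_p^×}`. -/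
def GU2 (p : ℕ) [Fact p.Prime] (a b : ℚ) : Subgroup (M2 p a b)ˣ where
  carrier := {g | ∃ ν : ℚ_[p], ν ≠ 0 ∧ (g : M2 p a b)ᴴ * (g : M2 p a b) = ν • 1}
  one_mem' := ⟨1, one_ne_zero, by simp⟩
  mul_mem' := by
    rintro g h ⟨ν, hν, hg⟩ ⟨μ, hμ, hh⟩
    refine ⟨ν * μ, mul_ne_zero hν hμ, ?_⟩
    rw [Units.val_mul, Matrix.conjTranspose_mul, Matrix.mul_assoc,
      ← Matrix.mul_assoc _ (g : M2 p a b), hg, Matrix.smul_mul, Matrix.one_mul,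
      Matrix.mul_smul, hh, smul_smul]
  inv_mem' := by
    rintro g ⟨ν, hν, hg⟩
    refine ⟨ν⁻¹, inv_ne_zero hν, ?_⟩
    have h1 : (g : M2 p a b)ᴴ = ν • ((g⁻¹ : (M2 p a b)ˣ) : M2 p a b) := by
      calc (g : M2 p a b)ᴴ = (g : M2 p a b)ᴴ * ((g : M2 p a b) * (g⁻¹ : (M2 p a b)ˣ)) := by simp
        _ = _ := by rw [← Matrix.mul_assoc, hg, Matrix.smul_mul, Matrix.one_mul]
    have h2 : ((g⁻¹ : (M2 p a b)ˣ) : M2 p a b) = ν⁻¹ • (g : M2 p a b)ᴴ := by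
      rw [h1, smul_smul, inv_mul_cancel₀ hν, one_smul]
    have h3 : ((g⁻¹ : (M2 p a b)ˣ) : M2 p a b)ᴴ * (g : M2 p a b)ᴴ = 1 := by
      rw [← Matrix.conjTranspose_mul]; simp
    nth_rewrite 2 [h2]
    rw [Matrix.mul_smul, h3]

/-- The central subgroup `ℚ_p^×` of scalar matrices in `GU_2(B_p)`. -/
def scalars (p : ℕ) [Fact p.Prime] (a b : ℚ) : Subgroup (GU2 p a b) where
  carrier := {g | ∃ c : ℚ_[p], c ≠ 0 ∧ ((g : (M2 p a b)ˣ) : M2 p a b) = c • 1}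
  one_mem' := ⟨1, one_ne_zero, by simp⟩
  mul_mem' := by
    rintro g h ⟨c, hc, hg⟩ ⟨d, hd, hh⟩
    exact ⟨c * d, mul_ne_zero hc hd, by simp [hg, hh, smul_smul, mul_comm]⟩
  inv_mem' := by
    rintro g ⟨c, hc, hg⟩
    refine ⟨c⁻¹, inv_ne_zero hc, ?_⟩
    have h : ((g : (M2 p a b)ˣ) : M2 p a b) * (((g : (M2 p a b)ˣ)⁻¹ : (M2 p a b)ˣ) : M2 p a b) = 1 :=
      Units.mul_inv _
    rw [hg, Matrix.smul_mul, Matrix.one_mul] at h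
    rw [Subgroup.coe_inv, ← h, smul_smul, inv_mul_cancel₀ hc, one_smul]

instance (p : ℕ) [Fact p.Prime] (a b : ℚ) : (scalars p a b).Normal where
  conj_mem := by
    rintro n ⟨c, hc, hn⟩ g
    exact ⟨c, hc, by simp [hn]⟩

/-- The hermitian form `H = (0 1; 1 0)`. -/
def H (p : ℕ) [Fact p.Prime] (a b : ℚ) : M2 p a b := !![0, 1; 1, 0]

/-- The `ℤ_p`-lattice `L_p = ξ (𝔭; R) ⊆ B_p^2` of column vectors, where `R` is the maximal order
and `𝔭` its maximal ideal, the set of elements of `R` whose norm is divisible by `p`. -/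
def L {p : ℕ} [Fact p.Prime] {a b : ℚ} (R : Subalgebra ℤ_[p] (Bp p a b)) (ξ : (M2 p a b)ˣ) :
    Set (Fin 2 → Bp p a b) :=
  {v | ∃ x ∈ R, ∃ y ∈ R, (∃ c : ℤ_[p], nrd x = (p : ℚ_[p]) * (c : ℚ_[p])) ∧
    v = (ξ : M2 p a b) *ᵥ ![x, y]}

/-- `K_p^-`: the stabiliser `{g : g L_p = L_p}` of `L_p` under left multiplication. -/
def Kminus {p : ℕ} [Fact p.Prime] {a b : ℚ} (R : Subalgebra ℤ_[p] (Bp p a b)) (ξ : (M2 p a b)ˣ) :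
    Subgroup (GU2 p a b) where
  carrier := {g | ∀ v, ((g : (M2 p a b)ˣ) : M2 p a b) *ᵥ v ∈ L R ξ ↔ v ∈ L R ξ}
  one_mem' := fun v => by simp
  mul_mem' := by
    intro g h hg hh v
    rw [Subgroup.coe_mul, Units.val_mul, ← Matrix.mulVec_mulVec]
    exact (hg _).trans (hh v)
  inv_mem' := by
    intro g hg v
    rw [← hg, Matrix.mulVec_mulVec, Subgroup.coe_inv, Units.mul_inv, Matrix.one_mulVec]

/-- The matrix `ω'_p = (0 p; 1 0)`. -/
def atkinLehner' (p : ℕ) [Fact p.Prime] (a b : ℚ) : (M2 p a b)ˣ where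
  val := !![0, (p : Bp p a b); 1, 0]
  inv := !![0, 1; algebraMap ℚ_[p] (Bp p a b) (p : ℚ_[p])⁻¹, 0]
  val_inv := by
    have hp : (p : ℚ_[p]) ≠ 0 := by exact_mod_cast (Fact.out : p.Prime).ne_zero
    have h : (p : Bp p a b) * algebraMap ℚ_[p] (Bp p a b) (p : ℚ_[p])⁻¹ = 1 := by
      rw [← map_natCast (algebraMap ℚ_[p] (Bp p a b)), ← map_mul, mul_inv_cancel₀ hp, map_one]
    simp only [Matrix.mul_fin_two, h, Matrix.one_fin_two]; simp
  inv_val := by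
    have hp : (p : ℚ_[p]) ≠ 0 := by exact_mod_cast (Fact.out : p.Prime).ne_zero
    have h : algebraMap ℚ_[p] (Bp p a b) (p : ℚ_[p])⁻¹ * (p : Bp p a b) = 1 := by
      rw [← map_natCast (algebraMap ℚ_[p] (Bp p a b)), ← map_mul, inv_mul_cancel₀ hp, map_one]
    simp only [Matrix.mul_fin_two, h, Matrix.one_fin_two]; simp

/-- The Atkin–Lehner element `ω_p = ξ ω'_p ξ⁻¹` of `GU_2(B_p)`, where `ξ^* ξ = H`. -/
def atkinLehner {p : ℕ} [Fact p.Prime] {a b : ℚ} (ξ : (M2 p a b)ˣ)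
    (hξ : (ξ : M2 p a b)ᴴ * (ξ : M2 p a b) = H p a b) : GU2 p a b :=
  ⟨ξ * atkinLehner' p a b * ξ⁻¹, by
    refine ⟨p, by exact_mod_cast (Fact.out : p.Prime).ne_zero, ?_⟩
    have h1 : ((atkinLehner' p a b : (M2 p a b)ˣ) : M2 p a b)ᴴ * (H p a b) * (atkinLehner' p a b : M2 p a b)
        = (p : ℚ_[p]) • H p a b := by
      have e : ((atkinLehner' p a b : (M2 p a b)ˣ) : M2 p a b) = !![0, (p : Bp p a b); 1, 0] := rfl
      have hs : (p : ℚ_[p]) • (1 : Bp p a b) = p := by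
        rw [← Algebra.algebraMap_eq_smul_one, map_natCast]
      rw [e, H]
      ext1 i j
      fin_cases i <;> fin_cases j <;>
        simp [Matrix.mul_apply, Fin.sum_univ_two, Matrix.conjTranspose_apply, hs]
    have h2 : ((ξ⁻¹ : (M2 p a b)ˣ) : M2 p a b)ᴴ * H p a b * ((ξ⁻¹ : (M2 p a b)ˣ) : M2 p a b) = 1 := by
      rw [← hξ, ← Matrix.mul_assoc, ← Matrix.conjTranspose_mul, Matrix.mul_assoc]; simp
    calc _ = ((ξ⁻¹ : (M2 p a b)ˣ) : M2 p a b)ᴴ *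
          ((atkinLehner' p a b : M2 p a b)ᴴ * ((ξ : M2 p a b)ᴴ * (ξ : M2 p a b)) * (atkinLehner' p a b : M2 p a b))
            * ((ξ⁻¹ : (M2 p a b)ˣ) : M2 p a b) := by
          simp only [Units.val_mul, Matrix.conjTranspose_mul, Matrix.mul_assoc]
      _ = _ := by
          rw [hξ, h1, Matrix.mul_smul, Matrix.smul_mul, h2]⟩

/-- The space `U_p = {A ∈ M_2(B_p) : A^* = A}` on which `GU_2(B_p)` acts by conjugation. -/
def Up (p : ℕ) [Fact p.Prime] (a b : ℚ) : Submodule ℚ_[p] (M2 p a b) where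
  carrier := {A | Aᴴ = A}
  zero_mem' := by simp
  add_mem' := by
    intro A B hA hB
    change (A + B)ᴴ = A + B
    rw [Matrix.conjTranspose_add, show Aᴴ = A from hA, show Bᴴ = B from hB]
  smul_mem' := by
    intro c A hA
    change (c • A)ᴴ = c • A
    ext1 i j
    have h : star (A j i) = A i j := congrFun (congrFun (show Aᴴ = A from hA) i) j
    rw [Matrix.conjTranspose_apply, Matrix.smul_apply, QuaternionAlgebra.star_smul, h,
      Matrix.smul_apply]

/-- The `ℤ_p`-module of matrices `(r ps; t r̄)` with `r` in the maximal order `R`, `s, t ∈ ℤ_p`. -/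
def latticeTilde {p : ℕ} [Fact p.Prime] {a b : ℚ} (R : Subalgebra ℤ_[p] (Bp p a b)) :
    Submodule ℤ_[p] (M2 p a b) where
  carrier := {A | ∃ r ∈ R, ∃ s t : ℤ_[p],
    A = !![r, algebraMap ℤ_[p] (Bp p a b) (p * s); algebraMap ℤ_[p] (Bp p a b) t, star r]}
  zero_mem' := ⟨0, zero_mem R, 0, 0, by ext1 i j; fin_cases i <;> fin_cases j <;> simp⟩
  add_mem' := by
    rintro _ _ ⟨r, hr, s, t, rfl⟩ ⟨r', hr', s', t', rfl⟩
    refine ⟨r + r', add_mem hr hr', s + s', t + t', ?_⟩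
    ext1 i j; fin_cases i <;> fin_cases j <;> simp [mul_add]
  smul_mem' := by
    rintro c _ ⟨r, hr, s, t, rfl⟩
    refine ⟨c • r, R.smul_mem hr c, c * s, c * t, ?_⟩
    ext1 i j
    fin_cases i <;> fin_cases j
    · simp
    · change c • algebraMap ℤ_[p] (Bp p a b) (p * s) = algebraMap ℤ_[p] (Bp p a b) (p * (c * s))
      rw [Algebra.smul_def, ← map_mul, mul_left_comm]
    · change c • algebraMap ℤ_[p] (Bp p a b) t = algebraMap ℤ_[p] (Bp p a b) (c * t)
      rw [Algebra.smul_def, ← map_mul]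
    · simp

/-- The lattice `𝔘_p^- = ξ 𝔘̃_p^- ξ⁻¹`. -/
def latticeU {p : ℕ} [Fact p.Prime] {a b : ℚ} (R : Subalgebra ℤ_[p] (Bp p a b)) (ξ : (M2 p a b)ˣ) :
    Submodule ℤ_[p] (M2 p a b) :=
  (latticeTilde R).map (LinearMap.mulLeftRight ℤ_[p]
    ((ξ : M2 p a b), ((ξ⁻¹ : (M2 p a b)ˣ) : M2 p a b)))

theorem mem_latticeU {p : ℕ} [Fact p.Prime] {a b : ℚ} {R : Subalgebra ℤ_[p] (Bp p a b)}
    {ξ : (M2 p a b)ˣ} {A : M2 p a b} :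
    A ∈ latticeU R ξ ↔
      ∃ C ∈ latticeTilde R, (ξ : M2 p a b) * C * ((ξ⁻¹ : (M2 p a b)ˣ) : M2 p a b) = A :=
  Iff.rfl

/-- The stabiliser `{g ∈ GU_2(B_p) : g Λ g⁻¹ = Λ}` of `Λ` for the conjugation action. -/
def stab {p : ℕ} [Fact p.Prime] {a b : ℚ} (Λ : Submodule ℤ_[p] (M2 p a b)) :
    Subgroup (GU2 p a b) where
  carrier := {g | ∀ A, ((g : (M2 p a b)ˣ) : M2 p a b) * A *
    (((g : (M2 p a b)ˣ)⁻¹ : (M2 p a b)ˣ) : M2 p a b) ∈ Λ ↔ A ∈ Λ}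
  one_mem' := fun A => by simp
  mul_mem' := by
    intro g h hg hh A
    have := (hg _).trans (hh A)
    simpa [Matrix.mul_assoc, mul_inv_rev] using this
  inv_mem' := by
    intro g hg A
    rw [← hg]
    simp [Matrix.mul_assoc]

end QuatUnitary

end

open QuatUnitary

/-!
Conjugation by `ξ` turns `𝔘_p^-` into the `H`-self-adjoint part of the endomorphism ring of the
column lattice `(𝔭; R)`. By Hensel's lemma the reduced norm of the division algebra `B_p` is
ultrametric, so `R` is its valuation ring, and the endomorphism ring is the unit ball for the
operator norm `|·|` attached to the grading of `(𝔭; R)`; an element of reduced norm of valuation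
one, needed to see all matrix entries on the lattice, comes from the Chevalley–Warning theorem.

Let `h` be a similitude of `H` with multiplier `ν`, so that `h⁻¹ = ν⁻¹ h'` with `h'` the adjoint
of `h` and `|h'| = |h|`. Conjugating the two off-diagonal matrix units of the lattice shows that `h`
stabilises it if and only if `|h| ≤ ‖ν‖`, whereas `h` stabilises `(𝔭; R)` if and only if moreover
`‖ν‖ = 1`. Since the Atkin–Lehner element stabilises the lattice and has multiplier `p`, one of
its powers carries any stabilising element into `K_p^-`.
-/

noncomputable section

namespace QuatUnitary

open Filter
open QuadraticMap (polar)

section Padic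

variable {p : ℕ} [Fact p.Prime]

theorem prime_cast_ne_zero : (p : ℚ_[p]) ≠ 0 :=
  Nat.cast_ne_zero.2 (Fact.out : p.Prime).ne_zero

theorem norm_prime_pos : 0 < ‖(p : ℚ_[p])‖ :=
  norm_pos_iff.2 prime_cast_ne_zero

theorem norm_lt_one_iff_le_norm_prime {x : ℚ_[p]} : ‖x‖ < 1 ↔ ‖x‖ ≤ ‖(p : ℚ_[p])‖ := by
  simpa [Padic.norm_p] using (Padic.norm_le_pow_iff_norm_lt_pow_add_one x (-1)).symm

theorem norm_eq_norm_prime_zpow_valuation {x : ℚ_[p]} (hx : x ≠ 0) :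
    ‖x‖ = ‖(p : ℚ_[p])‖ ^ x.valuation := by
  rw [Padic.norm_eq_zpow_neg_valuation hx, Padic.norm_p, inv_zpow, zpow_neg]

theorem exists_sq_sub_mul_add_eq_zero {t n : ℚ_[p]} (h : ‖n‖ < ‖t‖ ^ 2) :
    ∃ y : ℚ_[p], y ^ 2 - t * y + n = 0 := by
  have ht : t ≠ 0 := by
    rintro rfl
    exact (norm_nonneg n).not_gt (by simpa using h)
  have hc : ‖n / t ^ 2‖ < 1 := by
    rw [norm_div, norm_pow]
    exact (div_lt_one (by positivity)).2 h
  obtain ⟨c, hct⟩ : ∃ c : ℤ_[p], (c : ℚ_[p]) = n / t ^ 2 := ⟨⟨_, hc.le⟩, rfl⟩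
  rw [← hct] at hc
  obtain ⟨z, hz, -⟩ := hensels_lemma (p := p) (a := (0 : ℤ_[p]))
    (F := Polynomial.X ^ 2 - Polynomial.X + Polynomial.C c) (by simpa using hc)
  have hz' : (z : ℚ_[p]) ^ 2 - z + n / t ^ 2 = 0 := by
    rw [← hct]
    exact_mod_cast congrArg ((↑) : ℤ_[p] → ℚ_[p]) (by simpa using hz : z ^ 2 - z + c = 0)
  refine ⟨t * z, ?_⟩
  field_simp at hz'
  linear_combination hz'

end Padic

section AnisotropicForm

variable {p : ℕ} [Fact p.Prime] {V : Type*} [AddCommGroup V] [Module ℚ_[p] V]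
  {Q : QuadraticForm ℚ_[p] V}

theorem norm_polar_sq_le (hQ : Q.Anisotropic) (x y : V) :
    ‖polar Q x y‖ ^ 2 ≤ ‖Q x‖ * ‖Q y‖ := by
  by_contra! h
  -- Hensel's lemma splits the binary form spanned by `x` and `y`; anisotropy then forces `x` and
  -- `y` to be proportional, where the inequality is `‖4‖ ≤ 1`.
  obtain ⟨s, hs⟩ := exists_sq_sub_mul_add_eq_zero (n := Q x * Q y) (t := polar Q x y)
    (by rwa [norm_mul])
  have hx : Q x ≠ 0 := fun hx => by simp [hQ x hx] at h
  have hy : y = (s / Q x) • x := by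
    refine (sub_eq_zero.1 (hQ _ ?_)).symm
    rw [sub_eq_add_neg, QuadraticMap.map_add Q, QuadraticMap.polar_neg_right,
      QuadraticMap.polar_smul_left, QuadraticMap.map_smul, QuadraticMap.map_neg, smul_eq_mul,
      smul_eq_mul]
    field_simp
    linear_combination hs
  have h4 : polar Q x y ^ 2 = 4 * (Q x * Q y) := by
    rw [hy, QuadraticMap.polar_smul_right, QuadraticMap.polar_self, QuadraticMap.map_smul,
      smul_eq_mul, smul_eq_mul, nsmul_eq_mul]
    field_simp
    norm_num
  rw [← norm_pow, h4, norm_mul, norm_mul] at h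
  exact h.not_ge (mul_le_of_le_one_left (by positivity) (by exact_mod_cast Padic.norm_int_le_one 4))

theorem norm_map_add_le (hQ : Q.Anisotropic) {x y : V} {r : ℝ} (hx : ‖Q x‖ ≤ r) (hy : ‖Q y‖ ≤ r) :
    ‖Q (x + y)‖ ≤ r := by
  have hr : 0 ≤ r := (norm_nonneg _).trans hx
  have hpolar : ‖polar Q x y‖ ≤ r := by
    refine (sq_le_sq₀ (norm_nonneg _) hr).1 ((norm_polar_sq_le hQ x y).trans ?_)
    rw [sq]
    gcongr
  rw [QuadraticMap.map_add Q]
  exact (Padic.nonarchimedean _ _).trans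
    (max_le ((Padic.nonarchimedean _ _).trans (max_le hx hy)) hpolar)

theorem norm_polar_le_one (hQ : Q.Anisotropic) {x y : V} (hx : ‖Q x‖ ≤ 1) (hy : ‖Q y‖ ≤ 1) :
    ‖polar Q x y‖ ≤ 1 :=
  (sq_le_one_iff₀ (norm_nonneg _)).1
    ((norm_polar_sq_le hQ x y).trans (mul_le_one₀ hx (norm_nonneg _) hy))

theorem eventually_norm_map_pow_smul_le (Q : QuadraticForm ℚ_[p] V) (x : V) {ε : ℝ} (hε : 0 < ε) :
    ∀ᶠ n in atTop, ‖Q ((p : ℚ_[p]) ^ n • x)‖ ≤ ε := by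
  have h : Tendsto (fun n => (‖(p : ℚ_[p])‖ ^ n * ‖(p : ℚ_[p])‖ ^ n) * ‖Q x‖) atTop
      (nhds ((0 * 0) * ‖Q x‖)) :=
    have hp := tendsto_pow_atTop_nhds_zero_of_lt_one (norm_nonneg (p : ℚ_[p])) Padic.norm_p_lt_one
    (hp.mul hp).mul_const _
  rw [mul_zero, zero_mul] at h
  filter_upwards [h.eventually (gt_mem_nhds hε)] with n hn
  simpa only [QuadraticMap.map_smul, smul_eq_mul, norm_mul, norm_pow] using hn.le

variable [Module ℤ_[p] V] [IsScalarTower ℤ_[p] ℚ_[p] V]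

theorem map_padicInt_smul (Q : QuadraticForm ℚ_[p] V) (c : ℤ_[p]) (x : V) :
    Q (c • x) = (c : ℚ_[p]) * c * Q x := by
  rw [← algebraMap_smul ℚ_[p] c x, QuadraticMap.map_smul]
  rfl

theorem norm_map_padicInt_smul_le (Q : QuadraticForm ℚ_[p] V) (c : ℤ_[p]) (x : V) :
    ‖Q (c • x)‖ ≤ ‖Q x‖ := by
  rw [map_padicInt_smul, norm_mul, norm_mul]
  exact mul_le_of_le_one_left (norm_nonneg _) (mul_le_one₀ c.2 (norm_nonneg _) c.2)

theorem exists_norm_map_le_of_fg (hQ : Q.Anisotropic) {N : Submodule ℤ_[p] V} (hN : N.FG) :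
    ∃ C : ℝ, ∀ x ∈ N, ‖Q x‖ ≤ C := by
  obtain ⟨s, rfl⟩ := hN
  refine ⟨∑ y ∈ s, ‖Q y‖, fun x hx => ?_⟩
  induction hx using Submodule.span_induction with
  | mem y hy => exact Finset.single_le_sum (f := fun y => ‖Q y‖) (fun _ _ => norm_nonneg _) hy
  | zero => simpa using Finset.sum_nonneg fun y _ => norm_nonneg (Q y)
  | add x y _ _ hx hy => exact norm_map_add_le hQ hx hy
  | smul c x _ hx => exact (norm_map_padicInt_smul_le Q c x).trans hx

/-- The vectors at which an anisotropic quadratic form over `ℚ_p` is integral. By Hensel's lemma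
they form a `ℤ_p`-module, the unique maximal integral lattice of the form. -/
def integralLattice (hQ : Q.Anisotropic) : Submodule ℤ_[p] V where
  carrier := {x | ‖Q x‖ ≤ 1}
  zero_mem' := by simp
  add_mem' hx hy := norm_map_add_le hQ hx hy
  smul_mem' c x hx := (norm_map_padicInt_smul_le Q c x).trans hx

theorem mem_integralLattice {hQ : Q.Anisotropic} {x : V} : x ∈ integralLattice hQ ↔ ‖Q x‖ ≤ 1 :=
  Iff.rfl

theorem span_integralLattice (hQ : Q.Anisotropic) :
    Submodule.span ℚ_[p] (integralLattice hQ : Set V) = ⊤ := by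
  refine eq_top_iff.2 fun x _ => ?_
  obtain ⟨n, hn⟩ := (eventually_norm_map_pow_smul_le Q x one_pos).exists
  exact (Submodule.smul_mem_iff _ (pow_ne_zero n prime_cast_ne_zero)).1 (Submodule.subset_span hn)

end AnisotropicForm

theorem fg_of_bilinForm_integral {A K V : Type*} [CommRing A] [IsNoetherianRing A]
    [Field K] [Algebra A K] [AddCommGroup V] [Module K V] [Module A V] [IsScalarTower A K V]
    [Module.Finite K V] {B : LinearMap.BilinForm K V} (hB : B.Nondegenerate) {N : Submodule A V}
    (hspan : Submodule.span K (N : Set V) = ⊤)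
    (hint : ∀ x ∈ N, ∀ y ∈ N, B x y ∈ (1 : Submodule A K)) : N.FG := by
  classical
  let b := Module.Basis.ofSpan hspan.ge
  have hle : N ≤ B.dualSubmodule (Submodule.span A (Set.range b)) := fun x hx y hy =>
    hint x hx y (Submodule.span_le.2 (Module.Basis.ofSpan_subset hspan.ge) hy)
  have : Finite _ := Module.Finite.finite_basis b
  rw [LinearMap.BilinForm.dualSubmodule_span_of_basis B hB] at hle
  exact (Submodule.fg_span (Set.finite_range _)).of_le hle

theorem polarBilin_nondegenerate_of_anisotropic {K V : Type*} [Field K] [NeZero (2 : K)]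
    [AddCommGroup V] [Module K V] {Q : QuadraticForm K V} (hQ : Q.Anisotropic) :
    Q.polarBilin.Nondegenerate := by
  have hrefl : Q.polarBilin.IsRefl := fun x y h => (QuadraticMap.polar_comm Q y x).trans h
  refine hrefl.nondegenerate_iff_separatingLeft.2 fun x hx => hQ x ?_
  have h : 2 • Q x = 0 := (QuadraticMap.polar_self Q x).symm.trans (hx x)
  simpa [two_ne_zero] using h

open MvPolynomial in
theorem exists_ne_zero_dotProduct_mulVec_eq_zero {F ι : Type*} [Field F] [Finite F] [Fintype ι]
    (hι : 2 < Fintype.card ι) (M : Matrix ι ι F) : ∃ c : ι → F, c ≠ 0 ∧ c ⬝ᵥ M *ᵥ c = 0 := by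
  classical
  have := Fintype.ofFinite F
  obtain ⟨q, hchar⟩ := CharP.exists F
  have hq : q.Prime := CharP.char_is_prime F q
  let f : MvPolynomial ι F := ∑ i, X i * M.toMvPolynomial i
  have eval_f (c : ι → F) : eval c f = c ⬝ᵥ M *ᵥ c := by
    simp [f, dotProduct, Matrix.toMvPolynomial_eval_eq_apply]
  have hf : f.IsHomogeneous 2 := IsHomogeneous.sum _ _ _ fun i _ =>
    (isHomogeneous_X F i).mul (M.toMvPolynomial_isHomogeneous i)
  have hdvd := char_dvd_card_solutions q (hf.totalDegree_le.trans_lt hι)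
  let zero : {c : ι → F // eval c f = 0} := ⟨0, by rw [eval_f, zero_dotProduct]⟩
  have hcard : 0 < Fintype.card {c : ι → F // eval c f = 0} := Fintype.card_pos_iff.2 ⟨zero⟩
  obtain ⟨⟨c, hc⟩, hne⟩ := Fintype.exists_ne_of_one_lt_card
    (hq.one_lt.trans_le (Nat.le_of_dvd hcard hdvd)) zero
  exact ⟨c, fun h => hne (Subtype.ext h), (eval_f c).symm.trans hc⟩

theorem exists_primitive_prime_dvd_map {p : ℕ} [Fact p.Prime] {M : Type*} [AddCommGroup M]
    [Module ℤ_[p] M] [Module.Free ℤ_[p] M] [Module.Finite ℤ_[p] M] (q : QuadraticForm ℤ_[p] M)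
    (hM : 2 < Module.finrank ℤ_[p] M) : ∃ x, (∀ y, x ≠ (p : ℤ_[p]) • y) ∧ (p : ℤ_[p]) ∣ q x := by
  obtain ⟨B, rfl⟩ := LinearMap.BilinMap.toQuadraticMap_surjective q
  let b := Module.finBasis ℤ_[p] M
  let G := LinearMap.BilinForm.toMatrix b B
  obtain ⟨c, hc, hzero⟩ := exists_ne_zero_dotProduct_mulVec_eq_zero (by simpa using hM)
    (G.map PadicInt.toZMod)
  obtain ⟨d, rfl⟩ := (ZMod.ringHom_surjective (PadicInt.toZMod (p := p))).comp_left c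
  refine ⟨b.equivFun.symm d, fun y hy => hc (funext fun i => ?_), ?_⟩
  · have hd : d = b.equivFun ((p : ℤ_[p]) • y) := by rw [← hy, LinearEquiv.apply_symm_apply]
    simp [hd]
  · rw [← PadicInt.norm_lt_one_iff_dvd, ← PadicInt.mem_nonunits,
      ← IsLocalRing.mem_maximalIdeal, ← PadicInt.ker_toZMod, RingHom.mem_ker,
      LinearMap.BilinMap.toQuadraticMap_apply, ← LinearMap.BilinForm.dotProduct_toMatrix_mulVec,
      RingHom.map_dotProduct]
    convert! hzero using 2
    exact funext (RingHom.map_mulVec _ G d)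

section AnisotropicLattice

variable {p : ℕ} [Fact p.Prime] {V : Type*} [AddCommGroup V] [Module ℚ_[p] V] [Module ℤ_[p] V]
  [IsScalarTower ℤ_[p] ℚ_[p] V] {Q : QuadraticForm ℚ_[p] V}

/-- The values of an anisotropic quadratic form over `ℚ_p` on its maximal integral lattice. -/
def integralForm (hQ : Q.Anisotropic) : QuadraticForm ℤ_[p] (integralLattice hQ) :=
  QuadraticMap.ofPolar (fun x => ⟨Q x, x.2⟩)
    (fun c x => Subtype.ext (map_padicInt_smul Q c x))
    (fun x y z => Subtype.ext (QuadraticMap.polar_add_left Q (x : V) y z))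
    (fun c x y => Subtype.ext <| by
      change polar Q (c • (x : V)) y = (c : ℚ_[p]) * polar Q x y
      rw [← algebraMap_smul ℚ_[p] c (x : V), QuadraticMap.polar_smul_left]
      rfl)

variable [Module.Finite ℚ_[p] V]

theorem integralLattice_isLattice (hQ : Q.Anisotropic) :
    Submodule.IsLattice ℚ_[p] (integralLattice hQ) where
  fg := fg_of_bilinForm_integral (polarBilin_nondegenerate_of_anisotropic hQ)
    (span_integralLattice hQ) fun _ hx _ hy =>
      Submodule.mem_one.2 ⟨⟨_, norm_polar_le_one hQ hx hy⟩, rfl⟩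
  span_eq_top := span_integralLattice hQ

theorem exists_norm_map_eq_norm_prime (hQ : Q.Anisotropic) (hV : 2 < Module.finrank ℚ_[p] V) :
    ∃ x, ‖Q x‖ = ‖(p : ℚ_[p])‖ := by
  have := integralLattice_isLattice hQ
  have hrank : 2 < Module.finrank ℤ_[p] (integralLattice hQ) := by
    rwa [Module.finrank, Submodule.IsLattice.rank' ℚ_[p] (integralLattice hQ)]
  have := Submodule.IsLattice.free ℚ_[p] (integralLattice hQ)
  obtain ⟨x, hprim, hdvd⟩ := exists_primitive_prime_dvd_map (integralForm hQ) hrank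
  refine ⟨x, le_antisymm ?_ (not_lt.1 fun hlt => ?_)⟩
  · exact norm_lt_one_iff_le_norm_prime.1 ((PadicInt.norm_lt_one_iff_dvd _).2 hdvd)
  · have hy : (p : ℚ_[p])⁻¹ • (x : V) ∈ integralLattice hQ := by
      rw [mem_integralLattice, QuadraticMap.map_smul, smul_eq_mul, norm_mul, norm_mul, norm_inv]
      have hp := norm_prime_pos (p := p)
      have hQx : ‖Q x‖ / ‖(p : ℚ_[p])‖ ≤ ‖(p : ℚ_[p])‖ := by
        rw [← norm_div, ← norm_lt_one_iff_le_norm_prime, norm_div]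
        exact (div_lt_one hp).2 hlt
      field_simp at hQx ⊢
      exact hQx
    refine hprim ⟨_, hy⟩ (Subtype.ext ?_)
    change (x : V) = (p : ℤ_[p]) • ((p : ℚ_[p])⁻¹ • (x : V))
    rw [← algebraMap_smul ℚ_[p], map_natCast, smul_inv_smul₀ prime_cast_ne_zero]

end AnisotropicLattice

section ReducedNorm

variable {p : ℕ} [Fact p.Prime] {a b : ℚ}

theorem nrd_eq (x : Bp p a b) :
    nrd x = x.re ^ 2 - a * x.imI ^ 2 - b * x.imJ ^ 2 + a * b * x.imK ^ 2 := by
  simp only [nrd, QuaternionAlgebra.re_mul, QuaternionAlgebra.re_star, QuaternionAlgebra.imI_star,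
    QuaternionAlgebra.imJ_star, QuaternionAlgebra.imK_star]
  ring

@[simp] theorem nrd_zero : nrd (0 : Bp p a b) = 0 := by simp [nrd]

@[simp] theorem nrd_one : nrd (1 : Bp p a b) = 1 := by simp [nrd]

@[simp] theorem nrd_star (x : Bp p a b) : nrd (star x) = nrd x := by
  simp [nrd_eq]

@[simp] theorem nrd_mul (x y : Bp p a b) : nrd (x * y) = nrd x * nrd y := by
  simp only [nrd_eq, QuaternionAlgebra.re_mul, QuaternionAlgebra.imI_mul,
    QuaternionAlgebra.imJ_mul, QuaternionAlgebra.imK_mul]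
  ring

@[simp] theorem nrd_pow (x : Bp p a b) (n : ℕ) : nrd (x ^ n) = nrd x ^ n :=
  map_pow (⟨⟨nrd, nrd_one⟩, nrd_mul⟩ : Bp p a b →* ℚ_[p]) x n

@[simp] theorem nrd_smul (c : ℚ_[p]) (x : Bp p a b) : nrd (c • x) = c ^ 2 * nrd x := by
  simp only [nrd_eq, QuaternionAlgebra.re_smul, QuaternionAlgebra.imI_smul,
    QuaternionAlgebra.imJ_smul, QuaternionAlgebra.imK_smul, smul_eq_mul]
  ring

@[simp] theorem nrd_algebraMap (c : ℚ_[p]) : nrd (algebraMap ℚ_[p] (Bp p a b) c) = c ^ 2 := by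
  rw [Algebra.algebraMap_eq_smul_one, nrd_smul, nrd_one, mul_one]

@[simp] theorem nrd_natCast (n : ℕ) : nrd (n : Bp p a b) = (n : ℚ_[p]) ^ 2 := by
  rw [← map_natCast (algebraMap ℚ_[p] (Bp p a b)), nrd_algebraMap]

theorem polar_nrd (x y : Bp p a b) : polar nrd x y = 2 * (x * star y).re := by
  simp only [polar, nrd_eq, QuaternionAlgebra.re_add, QuaternionAlgebra.imI_add,
    QuaternionAlgebra.imJ_add, QuaternionAlgebra.imK_add,
    QuaternionAlgebra.re_mul, QuaternionAlgebra.re_star, QuaternionAlgebra.imI_star,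
    QuaternionAlgebra.imJ_star, QuaternionAlgebra.imK_star]
  ring

theorem nrd_eq_zero (hB : IsRamifiedAt p a b) {x : Bp p a b} : nrd x = 0 ↔ x = 0 := by
  refine ⟨fun h => by_contra fun hx => ?_, fun h => by rw [h, nrd_zero]⟩
  obtain ⟨u, rfl⟩ := hB x hx
  have hu := nrd_mul (u : Bp p a b) (u⁻¹ : (Bp p a b)ˣ)
  simp [h] at hu

/-- The reduced norm as a quadratic form over `ℚ_p`. -/
def nrdForm (p : ℕ) [Fact p.Prime] (a b : ℚ) : QuadraticForm ℚ_[p] (Bp p a b) :=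
  QuadraticMap.ofPolar nrd (fun c x => by rw [nrd_smul, sq, smul_eq_mul])
    (fun x y z => by simp only [polar_nrd, add_mul, QuaternionAlgebra.re_add, mul_add])
    (fun c x y => by
      simp only [polar_nrd, smul_mul_assoc, QuaternionAlgebra.re_smul, smul_eq_mul]
      ring)

theorem nrdForm_apply (x : Bp p a b) : nrdForm p a b x = nrd x := rfl

theorem nrdForm_anisotropic (hB : IsRamifiedAt p a b) : (nrdForm p a b).Anisotropic :=
  fun _ => (nrd_eq_zero hB).1

theorem norm_nrd_add_le (hB : IsRamifiedAt p a b) {x y : Bp p a b} {r : ℝ}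
    (hx : ‖nrd x‖ ≤ r) (hy : ‖nrd y‖ ≤ r) : ‖nrd (x + y)‖ ≤ r :=
  norm_map_add_le (nrdForm_anisotropic hB) hx hy

theorem norm_nrd_sum_le (hB : IsRamifiedAt p a b) {ι : Type*} {s : Finset ι} {f : ι → Bp p a b}
    {r : ℝ} (hr : 0 ≤ r) (hf : ∀ i ∈ s, ‖nrd (f i)‖ ≤ r) : ‖nrd (∑ i ∈ s, f i)‖ ≤ r :=
  Finset.sum_induction f (fun x => ‖nrd x‖ ≤ r) (fun _ _ => norm_nrd_add_le hB) (by simpa) hf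

theorem exists_norm_nrd_eq_norm_prime (hB : IsRamifiedAt p a b) :
    ∃ ϖ : Bp p a b, ‖nrd ϖ‖ = ‖(p : ℚ_[p])‖ :=
  exists_norm_map_eq_norm_prime (nrdForm_anisotropic hB)
    (by rw [QuaternionAlgebra.finrank_eq_four]; norm_num)

/-- The valuation ring of the division algebra `B_p`, the elements of integral reduced norm. -/
def valuationOrder (hB : IsRamifiedAt p a b) : Subalgebra ℤ_[p] (Bp p a b) :=
  (integralLattice (nrdForm_anisotropic hB)).toSubalgebra
    (by simp [mem_integralLattice, nrdForm_apply])
    (fun x y hx hy => by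
      simp only [mem_integralLattice, nrdForm_apply] at hx hy ⊢
      rw [nrd_mul, norm_mul]
      exact mul_le_one₀ hx (norm_nonneg _) hy)

theorem valuationOrder_isLattice (hB : IsRamifiedAt p a b) :
    Submodule.IsLattice ℚ_[p] (Subalgebra.toSubmodule (valuationOrder hB)) := by
  rw [valuationOrder, Submodule.toSubalgebra_toSubmodule]
  exact integralLattice_isLattice (nrdForm_anisotropic hB)

theorem norm_nrd_le_one_of_fg (hB : IsRamifiedAt p a b) {R : Subalgebra ℤ_[p] (Bp p a b)}
    (hR : (Subalgebra.toSubmodule R).FG) {x : Bp p a b} (hx : x ∈ R) : ‖nrd x‖ ≤ 1 := by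
  obtain ⟨C, hC⟩ := exists_norm_map_le_of_fg (nrdForm_anisotropic hB) hR
  by_contra! h
  obtain ⟨n, hn⟩ := pow_unbounded_of_one_lt C h
  have hpow : ‖nrd (x ^ n)‖ ≤ C := hC (x ^ n) (pow_mem hx n)
  rw [nrd_pow, norm_pow] at hpow
  exact hpow.not_gt hn

theorem IsMaximalOrder.mem_iff (hB : IsRamifiedAt p a b) {R : Subalgebra ℤ_[p] (Bp p a b)}
    (hR : IsMaximalOrder R) {x : Bp p a b} : x ∈ R ↔ ‖nrd x‖ ≤ 1 := by
  have hle : R ≤ valuationOrder hB := fun _ => norm_nrd_le_one_of_fg hB hR.prop.fg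
  exact ⟨fun hx => hle hx, fun hx => hR.le_of_ge (valuationOrder_isLattice hB) hle hx⟩

end ReducedNorm

section FormAdjoint

variable {p : ℕ} [Fact p.Prime] {a b : ℚ}

/-- The adjoint `X ↦ H⁻¹ X^* H` of the hermitian form `H`; note that `H⁻¹ = H`. -/
def formAdjoint (X : M2 p a b) : M2 p a b := H p a b * Xᴴ * H p a b

theorem H_mul_H : H p a b * H p a b = 1 := by
  simp [H, Matrix.one_fin_two]

theorem formAdjoint_apply (X : M2 p a b) (i j : Fin 2) :
    formAdjoint X i j = star (X j.rev i.rev) := by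
  fin_cases i <;> fin_cases j <;>
    simp [formAdjoint, H, Matrix.mul_apply, Matrix.vecMul, dotProduct, Fin.sum_univ_two, Fin.rev]

theorem formAdjoint_mul (X Y : M2 p a b) :
    formAdjoint (X * Y) = formAdjoint Y * formAdjoint X := by
  calc formAdjoint (X * Y) = H p a b * Yᴴ * (H p a b * H p a b) * Xᴴ * H p a b := by
        rw [H_mul_H, Matrix.mul_one, formAdjoint, Matrix.conjTranspose_mul, ← Matrix.mul_assoc]
    _ = formAdjoint Y * formAdjoint X := by simp only [formAdjoint, Matrix.mul_assoc]

theorem formAdjoint_formAdjoint (X : M2 p a b) : formAdjoint (formAdjoint X) = X := by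
  ext1 i j
  simp only [formAdjoint_apply, Fin.rev_rev, star_star]

theorem formAdjoint_smul (c : ℚ_[p]) (X : M2 p a b) :
    formAdjoint (c • X) = c • formAdjoint X := by
  ext1 i j
  simp only [formAdjoint_apply, Matrix.smul_apply, QuaternionAlgebra.star_smul]

theorem formAdjoint_conj {ξ : (M2 p a b)ˣ}
    (hξ : (ξ : M2 p a b)ᴴ * (ξ : M2 p a b) = H p a b) (A : M2 p a b) :
    formAdjoint ((↑ξ⁻¹ : M2 p a b) * A * (ξ : M2 p a b)) =
      (↑ξ⁻¹ : M2 p a b) * Aᴴ * (ξ : M2 p a b) := by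
  have hleft : H p a b * (ξ : M2 p a b)ᴴ = (↑ξ⁻¹ : M2 p a b) := by
    refine Units.eq_inv_of_mul_eq_one_right ?_
    rw [Matrix.mul_assoc, hξ, H_mul_H]
  have hright : (↑ξ⁻¹ : M2 p a b)ᴴ * H p a b = ξ := by
    rw [← hξ, ← Matrix.mul_assoc, ← Matrix.conjTranspose_mul, Units.mul_inv,
      Matrix.conjTranspose_one, Matrix.one_mul]
  calc formAdjoint ((↑ξ⁻¹ : M2 p a b) * A * (ξ : M2 p a b))
      = (H p a b * (ξ : M2 p a b)ᴴ) * Aᴴ * ((↑ξ⁻¹ : M2 p a b)ᴴ * H p a b) := by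
        simp only [formAdjoint, Matrix.conjTranspose_mul, Matrix.mul_assoc]
    _ = (↑ξ⁻¹ : M2 p a b) * Aᴴ * (ξ : M2 p a b) := by rw [hleft, hright]

/-- `h` is a similitude of the hermitian form `H` with multiplier `ν`. -/
def IsSimilitude (h : (M2 p a b)ˣ) (ν : ℚ_[p]) : Prop :=
  ν ≠ 0 ∧ formAdjoint (h : M2 p a b) * (h : M2 p a b) = ν • 1

namespace IsSimilitude

variable {h k : (M2 p a b)ˣ} {ν μ : ℚ_[p]}

theorem ne_zero (hh : IsSimilitude h ν) : ν ≠ 0 := hh.1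

theorem formAdjoint_mul_self (hh : IsSimilitude h ν) :
    formAdjoint (h : M2 p a b) * (h : M2 p a b) = ν • 1 :=
  hh.2

theorem formAdjoint_eq (hh : IsSimilitude h ν) :
    formAdjoint (h : M2 p a b) = ν • (↑h⁻¹ : M2 p a b) := by
  rw [← Units.mul_inv_cancel_right (formAdjoint (h : M2 p a b)) h, hh.formAdjoint_mul_self,
    Matrix.smul_mul, Matrix.one_mul]

theorem inv_eq (hh : IsSimilitude h ν) :
    (↑h⁻¹ : M2 p a b) = ν⁻¹ • formAdjoint (h : M2 p a b) := by
  rw [hh.formAdjoint_eq, inv_smul_smul₀ hh.ne_zero]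

theorem one : IsSimilitude (1 : (M2 p a b)ˣ) 1 :=
  ⟨one_ne_zero, by simp [formAdjoint, H_mul_H]⟩

theorem inv (hh : IsSimilitude h ν) : IsSimilitude h⁻¹ ν⁻¹ := by
  refine ⟨inv_ne_zero hh.ne_zero, ?_⟩
  rw [hh.inv_eq, formAdjoint_smul, formAdjoint_formAdjoint, ← hh.inv_eq, Matrix.smul_mul,
    Units.mul_inv]

theorem mul (hh : IsSimilitude h ν) (hk : IsSimilitude k μ) : IsSimilitude (h * k) (ν * μ) := by
  refine ⟨mul_ne_zero hh.ne_zero hk.ne_zero, ?_⟩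
  rw [Units.val_mul, formAdjoint_mul, Matrix.mul_assoc, ← Matrix.mul_assoc _ (h : M2 p a b),
    hh.formAdjoint_mul_self, Matrix.smul_mul, Matrix.one_mul, Matrix.mul_smul,
    hk.formAdjoint_mul_self, smul_smul]

theorem pow (hh : IsSimilitude h ν) (n : ℕ) : IsSimilitude (h ^ n) (ν ^ n) := by
  induction n with
  | zero => simpa only [pow_zero] using one
  | succ n ih => simpa only [pow_succ] using ih.mul hh

theorem zpow (hh : IsSimilitude h ν) (n : ℤ) : IsSimilitude (h ^ n) (ν ^ n) := by
  cases n with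
  | ofNat n => simpa only [Int.ofNat_eq_natCast, zpow_natCast] using hh.pow n
  | negSucc n => simpa only [zpow_negSucc] using (hh.pow (n + 1)).inv

theorem formAdjoint_conj_eq (hh : IsSimilitude h ν) {A : M2 p a b} (hA : formAdjoint A = A) :
    formAdjoint ((h : M2 p a b) * A * (↑h⁻¹ : M2 p a b)) =
      (h : M2 p a b) * A * (↑h⁻¹ : M2 p a b) := by
  rw [formAdjoint_mul, formAdjoint_mul, hA, hh.inv.formAdjoint_eq, inv_inv, hh.formAdjoint_eq,
    Matrix.smul_mul, Matrix.mul_smul, Matrix.mul_smul, inv_smul_smul₀ hh.ne_zero,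
    Matrix.mul_assoc]

end IsSimilitude

/-- The transport `g ↦ ξ⁻¹ g ξ` of `GU_2(B_p)` to the frame `ξ`, in which the standard hermitian
form becomes `H`. -/
def frameConj (ξ : (M2 p a b)ˣ) : GU2 p a b →* (M2 p a b)ˣ :=
  (MulAut.conj ξ⁻¹).toMonoidHom.comp (GU2 p a b).subtype

theorem frameConj_apply (ξ : (M2 p a b)ˣ) (g : GU2 p a b) :
    frameConj ξ g = ξ⁻¹ * (g : (M2 p a b)ˣ) * ξ := by
  simp [frameConj]

theorem exists_isSimilitude_frameConj {ξ : (M2 p a b)ˣ}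
    (hξ : (ξ : M2 p a b)ᴴ * (ξ : M2 p a b) = H p a b) (g : GU2 p a b) :
    ∃ ν, IsSimilitude (frameConj ξ g) ν := by
  obtain ⟨ν, hν, hg⟩ := g.2
  refine ⟨ν, hν, ?_⟩
  rw [frameConj_apply, Units.val_mul, Units.val_mul, formAdjoint_conj hξ]
  simp only [Matrix.mul_assoc]
  rw [Units.mul_inv_cancel_left, ← Matrix.mul_assoc _ _ (ξ : M2 p a b), hg, Matrix.smul_mul,
    Matrix.one_mul, Matrix.mul_smul, Units.inv_mul]

theorem frameConj_atkinLehner {ξ : (M2 p a b)ˣ}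
    (hξ : (ξ : M2 p a b)ᴴ * (ξ : M2 p a b) = H p a b) :
    frameConj ξ (atkinLehner ξ hξ) = atkinLehner' p a b := by
  rw [frameConj_apply, atkinLehner]
  group

theorem coe_atkinLehner' :
    (atkinLehner' p a b : M2 p a b) = !![0, (p : Bp p a b); 1, 0] :=
  rfl

theorem atkinLehner'_isSimilitude : IsSimilitude (atkinLehner' p a b) p := by
  refine ⟨prime_cast_ne_zero, ?_⟩
  rw [coe_atkinLehner']
  ext1 i j
  fin_cases i <;> fin_cases j <;>
    simp [Matrix.mul_apply, formAdjoint_apply, Fin.rev, Algebra.smul_def]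

end FormAdjoint

section GradedBall

variable {p : ℕ} [Fact p.Prime] {a b : ℚ}

/-- The matrices of operator norm at most `ρ`, where column vectors carry the norm
`max ‖nrd (v i)‖ * ‖p‖ ^ i` and `‖nrd ·‖` measures the entries. -/
def gradedBall (p : ℕ) [Fact p.Prime] (a b : ℚ) (ρ : ℝ) : Set (M2 p a b) :=
  {X | ∀ i j, ‖nrd (X i j)‖ * ‖(p : ℚ_[p])‖ ^ (i : ℕ) ≤ ρ * ‖(p : ℚ_[p])‖ ^ (j : ℕ)}

/-- The lattice of columns `(𝔭; R)`, as a ball for the norm `max ‖nrd (v i)‖ * ‖p‖ ^ i`. -/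
def columnLattice (p : ℕ) [Fact p.Prime] (a b : ℚ) : Set (Fin 2 → Bp p a b) :=
  {v | ∀ i, ‖nrd (v i)‖ * ‖(p : ℚ_[p])‖ ^ (i : ℕ) ≤ ‖(p : ℚ_[p])‖}

theorem mul_mem_gradedBall (hB : IsRamifiedAt p a b) {X Y : M2 p a b} {ρ σ : ℝ}
    (hX : X ∈ gradedBall p a b ρ) (hY : Y ∈ gradedBall p a b σ) :
    X * Y ∈ gradedBall p a b (ρ * σ) := by
  intro i j
  have hq := norm_prime_pos (p := p)
  have hρ : 0 ≤ ρ := nonneg_of_mul_nonneg_left ((by positivity : (0 : ℝ) ≤ _).trans (hX 0 0))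
    (by positivity)
  have hσ : 0 ≤ σ := nonneg_of_mul_nonneg_left ((by positivity : (0 : ℝ) ≤ _).trans (hY 0 0))
    (by positivity)
  rw [Matrix.mul_apply, ← le_div_iff₀ (by positivity)]
  refine norm_nrd_sum_le hB (by positivity) fun k _ => ?_
  rw [nrd_mul, norm_mul, le_div_iff₀ (by positivity)]
  calc ‖nrd (X i k)‖ * ‖nrd (Y k j)‖ * ‖(p : ℚ_[p])‖ ^ (i : ℕ)
      = ‖nrd (X i k)‖ * ‖(p : ℚ_[p])‖ ^ (i : ℕ) * ‖nrd (Y k j)‖ := by ring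
    _ ≤ ρ * ‖(p : ℚ_[p])‖ ^ (k : ℕ) * ‖nrd (Y k j)‖ := by
      exact mul_le_mul_of_nonneg_right (hX i k) (norm_nonneg _)
    _ = ρ * (‖nrd (Y k j)‖ * ‖(p : ℚ_[p])‖ ^ (k : ℕ)) := by ring
    _ ≤ ρ * (σ * ‖(p : ℚ_[p])‖ ^ (j : ℕ)) := by
      exact mul_le_mul_of_nonneg_left (hY k j) hρ
    _ = ρ * σ * ‖(p : ℚ_[p])‖ ^ (j : ℕ) := by ring

theorem smul_mem_gradedBall {X : M2 p a b} {ρ : ℝ} (c : ℚ_[p]) (hX : X ∈ gradedBall p a b ρ) :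
    c • X ∈ gradedBall p a b (‖c‖ ^ 2 * ρ) := by
  intro i j
  rw [Matrix.smul_apply, nrd_smul, norm_mul, norm_pow, mul_assoc, mul_assoc]
  exact mul_le_mul_of_nonneg_left (hX i j) (sq_nonneg _)

theorem formAdjoint_mem_gradedBall {X : M2 p a b} {ρ : ℝ} (hX : X ∈ gradedBall p a b ρ) :
    formAdjoint X ∈ gradedBall p a b ρ := by
  intro i j
  rw [formAdjoint_apply, nrd_star]
  have hq := norm_prime_pos (p := p)
  have h := hX j.rev i.rev
  fin_cases i <;> fin_cases j <;> simpa [Fin.rev, hq, -Padic.norm_p] using h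

theorem exists_pow_smul_mem_gradedBall (X : M2 p a b) :
    ∃ n : ℕ, (p : ℚ_[p]) ^ n • X ∈ gradedBall p a b 1 := by
  have hq := norm_prime_pos (p := p)
  have hentry (i j : Fin 2) : ∀ᶠ n : ℕ in atTop,
      ‖nrd ((p : ℚ_[p]) ^ n • X i j)‖ ≤ ‖(p : ℚ_[p])‖ ^ (j : ℕ) :=
    eventually_norm_map_pow_smul_le (nrdForm p a b) (X i j) (pow_pos hq _)
  obtain ⟨n, hn⟩ := (eventually_all.2 fun i => eventually_all.2 (hentry i)).exists
  refine ⟨n, fun i j => ?_⟩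
  rw [one_mul]
  exact (mul_le_of_le_one_right (norm_nonneg _)
    (pow_le_one₀ hq.le Padic.norm_p_lt_one.le)).trans (hn i j)

theorem atkinLehner'_mem_gradedBall :
    (atkinLehner' p a b : M2 p a b) ∈ gradedBall p a b ‖(p : ℚ_[p])‖ := by
  intro i j
  rw [coe_atkinLehner']
  fin_cases i <;> fin_cases j <;> simp [sq, -Padic.norm_p, mul_self_nonneg]

theorem mem_gradedBall_one_iff (hB : IsRamifiedAt p a b) {X : M2 p a b} :
    X ∈ gradedBall p a b 1 ↔ ∀ v ∈ columnLattice p a b, X *ᵥ v ∈ columnLattice p a b := by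
  have hq := norm_prime_pos (p := p)
  constructor
  · intro hX v hv i
    rw [Matrix.mulVec, dotProduct, ← le_div_iff₀ (by positivity)]
    refine norm_nrd_sum_le hB (by positivity) fun j _ => ?_
    rw [nrd_mul, norm_mul, le_div_iff₀ (by positivity)]
    calc ‖nrd (X i j)‖ * ‖nrd (v j)‖ * ‖(p : ℚ_[p])‖ ^ (i : ℕ)
        = ‖nrd (X i j)‖ * ‖(p : ℚ_[p])‖ ^ (i : ℕ) * ‖nrd (v j)‖ := by ring
      _ ≤ 1 * ‖(p : ℚ_[p])‖ ^ (j : ℕ) * ‖nrd (v j)‖ := by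
        exact mul_le_mul_of_nonneg_right (hX i j) (norm_nonneg _)
      _ = ‖nrd (v j)‖ * ‖(p : ℚ_[p])‖ ^ (j : ℕ) := by ring
      _ ≤ ‖(p : ℚ_[p])‖ := hv j
  · intro hX i j
    obtain ⟨ϖ, hϖ⟩ := exists_norm_nrd_eq_norm_prime hB
    have hϖj : ‖(p : ℚ_[p])‖ ^ (j.rev : ℕ) * ‖(p : ℚ_[p])‖ ^ (j : ℕ) = ‖(p : ℚ_[p])‖ := by
      fin_cases j <;> simp [Fin.rev]
    have hcol : Pi.single j (ϖ ^ (j.rev : ℕ)) ∈ columnLattice p a b := by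
      intro k
      obtain rfl | hk := eq_or_ne k j
      · rw [Pi.single_eq_same, nrd_pow, norm_pow, hϖ, hϖj]
      · simp [Pi.single_eq_of_ne hk]
    have himage := hX _ hcol i
    rw [Matrix.mulVec_single] at himage
    simp only [Pi.smul_apply, MulOpposite.smul_eq_mul_unop, MulOpposite.unop_op, Matrix.col_apply,
      nrd_mul, nrd_pow, norm_mul, norm_pow, hϖ] at himage
    refine le_of_mul_le_mul_right ?_ (pow_pos hq (j.rev : ℕ))
    calc ‖nrd (X i j)‖ * ‖(p : ℚ_[p])‖ ^ (i : ℕ) * ‖(p : ℚ_[p])‖ ^ (j.rev : ℕ)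
        = ‖nrd (X i j)‖ * ‖(p : ℚ_[p])‖ ^ (j.rev : ℕ) * ‖(p : ℚ_[p])‖ ^ (i : ℕ) := by ring
      _ ≤ ‖(p : ℚ_[p])‖ := himage
      _ = 1 * ‖(p : ℚ_[p])‖ ^ (j : ℕ) * ‖(p : ℚ_[p])‖ ^ (j.rev : ℕ) := by
        rw [one_mul, mul_comm, hϖj]

theorem mulVec_mem_columnLattice_iff (hB : IsRamifiedAt p a b) {h : (M2 p a b)ˣ} :
    (∀ v, (h : M2 p a b) *ᵥ v ∈ columnLattice p a b ↔ v ∈ columnLattice p a b) ↔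
      (h : M2 p a b) ∈ gradedBall p a b 1 ∧ (↑h⁻¹ : M2 p a b) ∈ gradedBall p a b 1 := by
  rw [mem_gradedBall_one_iff hB, mem_gradedBall_one_iff hB]
  constructor
  · refine fun hh => ⟨fun v => (hh v).2, fun v hv => (hh _).1 ?_⟩
    rwa [Matrix.mulVec_mulVec, Units.mul_inv, Matrix.one_mulVec]
  · rintro ⟨hh, hinv⟩ v
    refine ⟨fun hv => ?_, hh v⟩
    simpa only [Matrix.mulVec_mulVec, Units.inv_mul, Matrix.one_mulVec] using hinv _ hv

namespace IsSimilitude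

variable {h : (M2 p a b)ˣ} {ν : ℚ_[p]}

theorem inv_mem_gradedBall (hh : IsSimilitude h ν) (hmem : (h : M2 p a b) ∈ gradedBall p a b ‖ν‖) :
    (↑h⁻¹ : M2 p a b) ∈ gradedBall p a b ‖ν⁻¹‖ := by
  have hν := norm_pos_iff.2 hh.ne_zero
  rw [hh.inv_eq, show ‖ν⁻¹‖ = ‖ν⁻¹‖ ^ 2 * ‖ν‖ by rw [norm_inv]; field_simp]
  exact smul_mem_gradedBall ν⁻¹ (formAdjoint_mem_gradedBall hmem)

theorem norm_le_one (hB : IsRamifiedAt p a b) (hh : IsSimilitude h ν)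
    (hmem : (h : M2 p a b) ∈ gradedBall p a b 1) : ‖ν‖ ≤ 1 := by
  have hsq := mul_mem_gradedBall hB (formAdjoint_mem_gradedBall hmem) hmem 0 0
  rw [hh.formAdjoint_mul_self] at hsq
  simpa using hsq

theorem mem_and_inv_mem_gradedBall_one_iff (hB : IsRamifiedAt p a b) (hh : IsSimilitude h ν) :
    (h : M2 p a b) ∈ gradedBall p a b 1 ∧ (↑h⁻¹ : M2 p a b) ∈ gradedBall p a b 1 ↔
      ‖ν‖ = 1 ∧ (h : M2 p a b) ∈ gradedBall p a b 1 := by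
  constructor
  · rintro ⟨hmem, hinv⟩
    have hν : ‖ν‖⁻¹ ≤ 1 := by simpa only [norm_inv] using hh.inv.norm_le_one hB hinv
    exact ⟨(hh.norm_le_one hB hmem).antisymm ((inv_le_one₀ (norm_pos_iff.2 hh.ne_zero)).1 hν), hmem⟩
  · rintro ⟨hν, hmem⟩
    have hinv := hh.inv_mem_gradedBall (by rwa [hν])
    rw [norm_inv, hν, inv_one] at hinv
    exact ⟨hmem, hinv⟩

end IsSimilitude

end GradedBall

section Lattice

variable {p : ℕ} [Fact p.Prime] {a b : ℚ} {R : Subalgebra ℤ_[p] (Bp p a b)}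

theorem norm_sq_mul_pow_le_iff (c : ℚ_[p]) (i : Fin 2) :
    ‖c‖ ^ 2 * ‖(p : ℚ_[p])‖ ^ (i : ℕ) ≤ ‖(p : ℚ_[p])‖ ^ (i.rev : ℕ) ↔
      ‖c‖ * ‖(p : ℚ_[p])‖ ^ (i : ℕ) ≤ ‖(p : ℚ_[p])‖ := by
  have hq := norm_prime_pos (p := p)
  have hq1 := Padic.norm_p_lt_one (p := p)
  have hsq (d : ℚ_[p]) : ‖d‖ ^ 2 ≤ ‖(p : ℚ_[p])‖ ↔ ‖d‖ ≤ ‖(p : ℚ_[p])‖ := by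
    rw [← norm_lt_one_iff_le_norm_prime]
    refine ⟨fun h => (sq_lt_one_iff₀ (norm_nonneg d)).1 (h.trans_lt hq1), fun h => ?_⟩
    exact (pow_le_of_le_one (norm_nonneg d) h.le two_ne_zero).trans
      (norm_lt_one_iff_le_norm_prime.1 h)
  fin_cases i
  · simpa [Fin.rev] using hsq c
  · rw [← mul_le_mul_iff_left₀ hq]
    simpa [Fin.rev, sq, mul_assoc, mul_left_comm, -Padic.norm_p] using hsq (c * p)

theorem eq_algebraMap_re_of_star_eq {x : Bp p a b} (hx : star x = x) :
    x = algebraMap ℚ_[p] (Bp p a b) x.re := by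
  rw [QuaternionAlgebra.algebraMap_eq]
  ext
  · rfl
  · exact self_eq_neg.1 (by simpa using congrArg (·.imI) hx.symm)
  · exact self_eq_neg.1 (by simpa using congrArg (·.imJ) hx.symm)
  · exact self_eq_neg.1 (by simpa using congrArg (·.imK) hx.symm)

theorem algebraMap_padicInt (c : ℤ_[p]) :
    algebraMap ℤ_[p] (Bp p a b) c = algebraMap ℚ_[p] (Bp p a b) c :=
  IsScalarTower.algebraMap_apply ℤ_[p] ℚ_[p] (Bp p a b) c

theorem star_algebraMap_padicInt (c : ℤ_[p]) :
    star (algebraMap ℤ_[p] (Bp p a b) c) = algebraMap ℤ_[p] (Bp p a b) c := by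
  rw [algebraMap_padicInt]
  exact QuaternionAlgebra.star_coe _

theorem mem_latticeTilde_iff {A : M2 p a b} :
    A ∈ latticeTilde R ↔ formAdjoint A = A ∧ A 0 0 ∈ R ∧
      ∀ i : Fin 2, ‖(A i i.rev).re‖ * ‖(p : ℚ_[p])‖ ^ (i : ℕ) ≤ ‖(p : ℚ_[p])‖ := by
  have hq := norm_prime_pos (p := p)
  constructor
  · rintro ⟨r, hr, s, t, rfl⟩
    refine ⟨?_, hr, fun i => ?_⟩
    · ext1 i j
      rw [formAdjoint_apply]
      fin_cases i <;> fin_cases j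
      exacts [star_star r, star_algebraMap_padicInt _, star_algebraMap_padicInt _, rfl]
    · fin_cases i
      · simpa [Fin.rev, algebraMap_padicInt, QuaternionAlgebra.algebraMap_eq, -map_mul, hq,
          -Padic.norm_p] using s.2
      · simpa [Fin.rev, algebraMap_padicInt, QuaternionAlgebra.algebraMap_eq, hq,
          -Padic.norm_p] using t.2
  · rintro ⟨hA, hr, hoff⟩
    have hstar (i j : Fin 2) : star (A j.rev i.rev) = A i j := by rw [← formAdjoint_apply, hA]
    obtain ⟨s, hs⟩ : ∃ s : ℤ_[p], (p : ℚ_[p]) * s = (A 0 1).re := by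
      refine ⟨⟨(p : ℚ_[p])⁻¹ * (A 0 1).re, ?_⟩, mul_inv_cancel_left₀ prime_cast_ne_zero _⟩
      rw [norm_mul, norm_inv, inv_mul_le_iff₀ hq, mul_one]
      simpa using hoff 0
    obtain ⟨t, ht⟩ : ∃ t : ℤ_[p], (t : ℚ_[p]) = (A 1 0).re :=
      ⟨⟨_, by simpa [hq, Fin.rev, -Padic.norm_p] using hoff 1⟩, rfl⟩
    have h01 : A 0 1 = algebraMap ℤ_[p] (Bp p a b) (p * s) := by
      rw [algebraMap_padicInt, PadicInt.coe_mul, PadicInt.coe_natCast, hs]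
      exact eq_algebraMap_re_of_star_eq (hstar 0 1)
    have h10 : A 1 0 = algebraMap ℤ_[p] (Bp p a b) t := by
      rw [algebraMap_padicInt, ht]
      exact eq_algebraMap_re_of_star_eq (hstar 1 0)
    refine ⟨A 0 0, hr, s, t, ?_⟩
    rw [← h01, ← h10, show star (A 0 0) = A 1 1 from hstar 1 1]
    exact Matrix.eta_fin_two A

theorem IsMaximalOrder.mem_latticeTilde_iff (hB : IsRamifiedAt p a b) (hR : IsMaximalOrder R)
    {A : M2 p a b} :
    A ∈ latticeTilde R ↔ formAdjoint A = A ∧ A ∈ gradedBall p a b 1 := by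
  rw [QuatUnitary.mem_latticeTilde_iff, hR.mem_iff hB]
  refine and_congr_right fun hA => ?_
  have hstar (i j : Fin 2) : star (A j.rev i.rev) = A i j := by rw [← formAdjoint_apply, hA]
  have hnrd (i : Fin 2) : nrd (A i i.rev) = (A i i.rev).re ^ 2 := by
    rw [← nrd_algebraMap (a := a) (b := b), ← eq_algebraMap_re_of_star_eq]
    simpa using hstar i i.rev
  have hoff (i : Fin 2) : ‖(A i i.rev).re‖ * ‖(p : ℚ_[p])‖ ^ (i : ℕ) ≤ ‖(p : ℚ_[p])‖ ↔
      ‖nrd (A i i.rev)‖ * ‖(p : ℚ_[p])‖ ^ (i : ℕ) ≤ ‖(p : ℚ_[p])‖ ^ (i.rev : ℕ) := by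
    rw [hnrd, norm_pow, norm_sq_mul_pow_le_iff]
  have hdiag : nrd (A 1 1) = nrd (A 0 0) := by rw [← hstar, nrd_star]; rfl
  have hq := norm_prime_pos (p := p)
  simp only [hoff, gradedBall, Set.mem_ofPred_eq, Fin.forall_fin_two, hdiag]
  simp only [Fin.isValue, Fin.rev, Fin.coe_ofNat_eq_mod, Nat.zero_mod, zero_add,
    Nat.add_one_sub_one, Fin.mk_one, pow_zero, mul_one, Nat.mod_succ, pow_one, Nat.reduceAdd,
    tsub_self, Fin.zero_eta, one_mul, hq, mul_le_iff_le_one_left]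
  tauto

theorem IsMaximalOrder.mem_L_iff (hB : IsRamifiedAt p a b) (hR : IsMaximalOrder R)
    {ξ : (M2 p a b)ˣ} {v : Fin 2 → Bp p a b} :
    v ∈ L R ξ ↔ (↑ξ⁻¹ : M2 p a b) *ᵥ v ∈ columnLattice p a b := by
  have hq := norm_prime_pos (p := p)
  have hcol (w : Fin 2 → Bp p a b) :
      w ∈ columnLattice p a b ↔ ‖nrd (w 0)‖ ≤ ‖(p : ℚ_[p])‖ ∧ ‖nrd (w 1)‖ ≤ 1 := by
    simp [columnLattice, Fin.forall_fin_two, hq, -Padic.norm_p]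
  rw [hcol]
  constructor
  · rintro ⟨x, -, y, hy, ⟨c, hc⟩, rfl⟩
    rw [Matrix.mulVec_mulVec, Units.inv_mul, Matrix.one_mulVec]
    refine ⟨?_, (hR.mem_iff hB).1 hy⟩
    rw [Matrix.cons_val_zero, hc, norm_mul]
    exact mul_le_of_le_one_right hq.le c.2
  · obtain ⟨w, rfl⟩ : ∃ w, v = (ξ : M2 p a b) *ᵥ w :=
      ⟨(↑ξ⁻¹ : M2 p a b) *ᵥ v, by rw [Matrix.mulVec_mulVec, Units.mul_inv, Matrix.one_mulVec]⟩
    rw [Matrix.mulVec_mulVec, Units.inv_mul, Matrix.one_mulVec]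
    rintro ⟨hx, hy⟩
    refine ⟨w 0, (hR.mem_iff hB).2 (hx.trans Padic.norm_p_lt_one.le), w 1, (hR.mem_iff hB).2 hy,
      ⟨⟨(p : ℚ_[p])⁻¹ * nrd (w 0), ?_⟩, (mul_inv_cancel_left₀ prime_cast_ne_zero _).symm⟩,
      congrArg _ (FinVec.etaExpand_eq w).symm⟩
    rwa [norm_mul, norm_inv, inv_mul_le_iff₀ hq, mul_one]

end Lattice

section Stabilizer

variable {p : ℕ} [Fact p.Prime] {a b : ℚ} {R : Subalgebra ℤ_[p] (Bp p a b)} {ξ : (M2 p a b)ˣ}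

namespace IsSimilitude

variable {h : (M2 p a b)ˣ} {ν : ℚ_[p]}

theorem conj_mem_latticeTilde (hB : IsRamifiedAt p a b) (hR : IsMaximalOrder R)
    (hh : IsSimilitude h ν) (hmem : (h : M2 p a b) ∈ gradedBall p a b ‖ν‖) {A : M2 p a b}
    (hA : A ∈ latticeTilde R) : (h : M2 p a b) * A * (↑h⁻¹ : M2 p a b) ∈ latticeTilde R := by
  rw [hR.mem_latticeTilde_iff hB] at hA ⊢
  refine ⟨hh.formAdjoint_conj_eq hA.1, ?_⟩
  have hconj := mul_mem_gradedBall hB (mul_mem_gradedBall hB hmem hA.2) (hh.inv_mem_gradedBall hmem)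
  rwa [mul_one, ← norm_mul, mul_inv_cancel₀ hh.ne_zero, norm_one] at hconj

/-- Conjugates of the matrix units in `latticeTilde R` thus read off the reduced norms of the
entries of `h`. -/
theorem conj_single_apply (hh : IsSimilitude h ν) (c : ℚ_[p]) (i k : Fin 2) :
    ((h : M2 p a b) * Matrix.single k k.rev (algebraMap ℚ_[p] (Bp p a b) c) *
        (↑h⁻¹ : M2 p a b)) i i.rev =
      algebraMap ℚ_[p] (Bp p a b) (ν⁻¹ * c * nrd ((h : M2 p a b) i k)) := by
  rw [hh.inv_eq, Matrix.mul_smul, Matrix.smul_apply, Matrix.mul_apply,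
    Finset.sum_eq_single_of_mem k.rev (Finset.mem_univ _)
      fun l _ hl => by rw [Matrix.mul_single_apply_of_ne (hbj := hl), zero_mul],
    Matrix.mul_single_apply_same, formAdjoint_apply, Fin.rev_rev, Fin.rev_rev,
    ← Algebra.commutes, mul_assoc, ← algebraMap_nrd, ← map_mul, Algebra.smul_def, ← map_mul,
    mul_assoc]

end IsSimilitude

theorem single_mem_latticeTilde (k : Fin 2) :
    Matrix.single k k.rev (algebraMap ℚ_[p] (Bp p a b) ((p : ℚ_[p]) ^ (k.rev : ℕ))) ∈
      latticeTilde R := by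
  fin_cases k
  · refine ⟨0, zero_mem R, 1, 0, ?_⟩
    ext1 i j
    fin_cases i <;> fin_cases j <;> simp [Fin.rev]
  · refine ⟨0, zero_mem R, 0, 1, ?_⟩
    ext1 i j
    fin_cases i <;> fin_cases j <;> simp [Fin.rev]

theorem IsSimilitude.mem_gradedBall_of_conj_mem {h : (M2 p a b)ˣ} {ν : ℚ_[p]}
    (hh : IsSimilitude h ν)
    (hconj : ∀ A ∈ latticeTilde R, (h : M2 p a b) * A * (↑h⁻¹ : M2 p a b) ∈ latticeTilde R) :
    (h : M2 p a b) ∈ gradedBall p a b ‖ν‖ := by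
  intro i k
  have hq := norm_prime_pos (p := p)
  have hν := norm_pos_iff.2 hh.ne_zero
  have hentry := (mem_latticeTilde_iff.1 (hconj _ (single_mem_latticeTilde k))).2.2 i
  have hk : ‖(p : ℚ_[p])‖ ^ (k : ℕ) * ‖(p : ℚ_[p])‖ ^ (k.rev : ℕ) = ‖(p : ℚ_[p])‖ := by
    fin_cases k <;> simp [Fin.rev]
  rw [hh.conj_single_apply, QuaternionAlgebra.algebraMap_eq, norm_mul, norm_mul, norm_inv,
    norm_pow, mul_assoc, mul_assoc, inv_mul_le_iff₀ hν] at hentry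
  refine le_of_mul_le_mul_left ?_ (pow_pos hq (k.rev : ℕ))
  calc _ ≤ ‖ν‖ * ‖(p : ℚ_[p])‖ := hentry
    _ = _ := by rw [mul_comm (_ ^ _), mul_assoc, hk]

theorem mem_latticeU_iff {A : M2 p a b} :
    A ∈ latticeU R ξ ↔ (↑ξ⁻¹ : M2 p a b) * A * (ξ : M2 p a b) ∈ latticeTilde R := by
  rw [mem_latticeU]
  refine ⟨?_, fun hA => ⟨_, hA, by simp [Matrix.mul_assoc]⟩⟩
  rintro ⟨C, hC, rfl⟩
  simpa [Matrix.mul_assoc] using hC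

theorem mem_stab_latticeU_iff {g : GU2 p a b} :
    g ∈ stab (latticeU R ξ) ↔ ∀ A, (frameConj ξ g : M2 p a b) * A *
      (↑(frameConj ξ g)⁻¹ : M2 p a b) ∈ latticeTilde R ↔ A ∈ latticeTilde R := by
  change (∀ A, _ ∈ latticeU R ξ ↔ A ∈ latticeU R ξ) ↔ _
  simp only [mem_latticeU_iff, frameConj_apply]
  constructor <;> intro h A
  · simpa [mul_inv_rev, Matrix.mul_assoc] using
      h ((ξ : M2 p a b) * A * (↑ξ⁻¹ : M2 p a b))
  · simpa [mul_inv_rev, Matrix.mul_assoc] using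
      h ((↑ξ⁻¹ : M2 p a b) * A * (ξ : M2 p a b))

theorem mem_stab_latticeU_iff_mem_gradedBall (hB : IsRamifiedAt p a b) (hR : IsMaximalOrder R)
    {g : GU2 p a b} {ν : ℚ_[p]} (hg : IsSimilitude (frameConj ξ g) ν) :
    g ∈ stab (latticeU R ξ) ↔ (frameConj ξ g : M2 p a b) ∈ gradedBall p a b ‖ν‖ := by
  rw [mem_stab_latticeU_iff]
  refine ⟨fun h => hg.mem_gradedBall_of_conj_mem fun A => (h A).2, fun h A =>
    ⟨fun hA => ?_, hg.conj_mem_latticeTilde hB hR h⟩⟩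
  simpa [← Matrix.mul_assoc, Matrix.mul_assoc _ (↑(frameConj ξ g)⁻¹ : M2 p a b)] using
    hg.inv.conj_mem_latticeTilde hB hR (hg.inv_mem_gradedBall h) hA

theorem mem_Kminus_iff (hB : IsRamifiedAt p a b) (hR : IsMaximalOrder R) {g : GU2 p a b} :
    g ∈ Kminus R ξ ↔ ∀ v, (frameConj ξ g : M2 p a b) *ᵥ v ∈ columnLattice p a b ↔
      v ∈ columnLattice p a b := by
  change (∀ v, _ ∈ L R ξ ↔ v ∈ L R ξ) ↔ _
  have hsurj : Function.Surjective fun v => (↑ξ⁻¹ : M2 p a b) *ᵥ v := fun v =>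
    ⟨(ξ : M2 p a b) *ᵥ v, by simp only [Matrix.mulVec_mulVec, Units.inv_mul, Matrix.one_mulVec]⟩
  refine Iff.trans ?_ hsurj.forall.symm
  simp only [hR.mem_L_iff hB, frameConj_apply, Units.val_mul, Matrix.mulVec_mulVec,
    Units.mul_inv_cancel_right]

theorem mem_Kminus_iff_mem_gradedBall (hB : IsRamifiedAt p a b) (hR : IsMaximalOrder R)
    {g : GU2 p a b} {ν : ℚ_[p]} (hg : IsSimilitude (frameConj ξ g) ν) :
    g ∈ Kminus R ξ ↔ ‖ν‖ = 1 ∧ (frameConj ξ g : M2 p a b) ∈ gradedBall p a b 1 := by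
  rw [mem_Kminus_iff hB hR, mulVec_mem_columnLattice_iff hB,
    hg.mem_and_inv_mem_gradedBall_one_iff hB]

theorem mem_Kminus_iff_mem_stab (hB : IsRamifiedAt p a b) (hR : IsMaximalOrder R)
    {g : GU2 p a b} {ν : ℚ_[p]} (hg : IsSimilitude (frameConj ξ g) ν) :
    g ∈ Kminus R ξ ↔ ‖ν‖ = 1 ∧ g ∈ stab (latticeU R ξ) := by
  rw [mem_Kminus_iff_mem_gradedBall hB hR hg, mem_stab_latticeU_iff_mem_gradedBall hB hR hg]
  exact and_congr_right fun hν => by rw [hν]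

theorem atkinLehner_mem_stab (hB : IsRamifiedAt p a b) (hR : IsMaximalOrder R)
    (hξ : (ξ : M2 p a b)ᴴ * (ξ : M2 p a b) = H p a b) :
    atkinLehner ξ hξ ∈ stab (latticeU R ξ) := by
  have hω : IsSimilitude (frameConj ξ (atkinLehner ξ hξ)) p := by
    rw [frameConj_atkinLehner]
    exact atkinLehner'_isSimilitude
  rw [mem_stab_latticeU_iff_mem_gradedBall hB hR hω, frameConj_atkinLehner]
  exact atkinLehner'_mem_gradedBall

theorem Kminus_le_stab (hB : IsRamifiedAt p a b) (hR : IsMaximalOrder R)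
    (hξ : (ξ : M2 p a b)ᴴ * (ξ : M2 p a b) = H p a b) : Kminus R ξ ≤ stab (latticeU R ξ) := by
  intro g hg
  obtain ⟨ν, hν⟩ := exists_isSimilitude_frameConj hξ g
  exact ((mem_Kminus_iff_mem_stab hB hR hν).1 hg).2

theorem closure_Kminus_atkinLehner (hB : IsRamifiedAt p a b) (hR : IsMaximalOrder R)
    (hξ : (ξ : M2 p a b)ᴴ * (ξ : M2 p a b) = H p a b) :
    Subgroup.closure ((Kminus R ξ : Set (GU2 p a b)) ∪ {atkinLehner ξ hξ}) =
      stab (latticeU R ξ) := by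
  set ω := atkinLehner ξ hξ
  have hω : ω ∈ stab (latticeU R ξ) := atkinLehner_mem_stab hB hR hξ
  refine le_antisymm ?_ fun g hg => ?_
  · rw [Subgroup.closure_le]
    exact Set.union_subset (Kminus_le_stab hB hR hξ) (Set.singleton_subset_iff.2 hω)
  obtain ⟨ν, hν⟩ := exists_isSimilitude_frameConj hξ g
  set n := ν.valuation
  have hunit : ‖(p : ℚ_[p]) ^ (-n) * ν‖ = 1 := by
    rw [norm_mul, norm_zpow, norm_eq_norm_prime_zpow_valuation hν.ne_zero,
      ← zpow_add₀ norm_prime_pos.ne', neg_add_cancel, zpow_zero]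
  have hsim : IsSimilitude (frameConj ξ (ω ^ (-n) * g)) ((p : ℚ_[p]) ^ (-n) * ν) := by
    rw [map_mul, map_zpow, frameConj_atkinLehner]
    exact (atkinLehner'_isSimilitude.zpow _).mul hν
  have hk : ω ^ (-n) * g ∈ Kminus R ξ :=
    (mem_Kminus_iff_mem_stab hB hR hsim).2 ⟨hunit, mul_mem (zpow_mem hω _) hg⟩
  rw [show g = ω ^ n * (ω ^ (-n) * g) by group]
  exact mul_mem (zpow_mem (Subgroup.subset_closure (.inr rfl)) n)
    (Subgroup.subset_closure (.inl hk))

end Stabilizer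

section FullLattice

variable {p : ℕ} [Fact p.Prime] {a b : ℚ} {R : Subalgebra ℤ_[p] (Bp p a b)} {ξ : (M2 p a b)ˣ}

theorem latticeTilde_fg (hR : (Subalgebra.toSubmodule R).FG)
    (hstar : ∀ r ∈ R, star r ∈ R) : (latticeTilde R).FG := by
  let T : Submodule ℤ_[p] (Fin 2 → Fin 2 → Bp p a b) :=
    Submodule.pi Set.univ fun _ => Submodule.pi Set.univ fun _ => Subalgebra.toSubmodule R
  have hT : T.FG := Submodule.fg_pi fun _ => Submodule.fg_pi fun _ => hR
  refine Submodule.FG.of_le (T := (T : Submodule ℤ_[p] (M2 p a b))) hT ?_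
  rintro _ ⟨r, hr, s, t, rfl⟩ i - j -
  fin_cases i <;> fin_cases j
  exacts [hr, R.algebraMap_mem _, R.algebraMap_mem _, hstar r hr]

theorem latticeU_fg (hB : IsRamifiedAt p a b) (hR : IsMaximalOrder R) : (latticeU R ξ).FG :=
  (latticeTilde_fg hR.prop.fg fun r hr => by
    rw [hR.mem_iff hB] at hr ⊢
    rwa [nrd_star]).map _

theorem mem_Up_iff_formAdjoint_conj_eq (hξ : (ξ : M2 p a b)ᴴ * (ξ : M2 p a b) = H p a b)
    {A : M2 p a b} :
    A ∈ Up p a b ↔ formAdjoint ((↑ξ⁻¹ : M2 p a b) * A * (ξ : M2 p a b)) =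
      (↑ξ⁻¹ : M2 p a b) * A * (ξ : M2 p a b) := by
  rw [formAdjoint_conj hξ, Units.mul_left_inj, Units.mul_right_inj]
  rfl

theorem span_latticeU (hB : IsRamifiedAt p a b) (hR : IsMaximalOrder R)
    (hξ : (ξ : M2 p a b)ᴴ * (ξ : M2 p a b) = H p a b) :
    Submodule.span ℚ_[p] (latticeU R ξ : Set (M2 p a b)) = Up p a b := by
  refine le_antisymm (Submodule.span_le.2 fun A hA => ?_) fun A hA => ?_
  · rw [SetLike.mem_coe, mem_Up_iff_formAdjoint_conj_eq hξ]
    exact ((hR.mem_latticeTilde_iff hB).1 (mem_latticeU_iff.1 hA)).1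
  · rw [mem_Up_iff_formAdjoint_conj_eq hξ] at hA
    obtain ⟨n, hn⟩ :=
      exists_pow_smul_mem_gradedBall ((↑ξ⁻¹ : M2 p a b) * A * (ξ : M2 p a b))
    have hmem : (p : ℚ_[p]) ^ n • A ∈ latticeU R ξ := by
      rw [mem_latticeU_iff, Matrix.mul_smul, Matrix.smul_mul, hR.mem_latticeTilde_iff hB]
      exact ⟨by rw [formAdjoint_smul, hA], hn⟩
    rw [← inv_smul_smul₀ (pow_ne_zero n (prime_cast_ne_zero (p := p))) A]
    exact Submodule.smul_mem _ _ (Submodule.subset_span hmem)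

end FullLattice

end QuatUnitary

end

theorem mainTheorem11 (p : ℕ) [Fact p.Prime] (a b : ℚ) (hB : IsRamifiedAt p a b)
    (R : Subalgebra ℤ_[p] (Bp p a b)) (hR : IsMaximalOrder R)
    (ξ : (M2 p a b)ˣ) (hξ : (ξ : M2 p a b)ᴴ * (ξ : M2 p a b) = H p a b) :
    -- the lattice is a full lattice in the space of hermitian matrices
    (latticeU R ξ).FG ∧
    Submodule.span ℚ_[p] (latticeU R ξ : Set (M2 p a b)) = Up p a b ∧
    -- it is preserved by the stabiliser of `L_p` and by the Atkin–Lehner element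
    Kminus R ξ ≤ stab (latticeU R ξ) ∧
    atkinLehner ξ hξ ∈ stab (latticeU R ξ) ∧
    -- modulo scalars these generate its full stabiliser
    Subgroup.closure
        (QuotientGroup.mk' (scalars p a b) '' (Kminus R ξ : Set (GU2 p a b)) ∪
          {QuotientGroup.mk' (scalars p a b) (atkinLehner ξ hξ)}) =
      (stab (latticeU R ξ)).map (QuotientGroup.mk' (scalars p a b)) := by
  refine ⟨latticeU_fg hB hR, span_latticeU hB hR hξ, Kminus_le_stab hB hR hξ,
    atkinLehner_mem_stab hB hR hξ, ?_⟩
  rw [← closure_Kminus_atkinLehner hB hR hξ, MonoidHom.map_closure, Set.image_union,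
    Set.image_singleton]
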